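/- Let $\aleph$ be an infinite cardinal, let $n\ge 1$, and for $i=1,\dots,n$ let $X_i=\prod_{s\in S_i}X_{i,s}$ be the topological product of a family of metrizable spaces $X_{i,s}$, each having at least two points. Suppose $|S_1|>\aleph$, and let $X=X_1\times\cdots\times X_n$ with the product topology. Terminology. A map $f$ on a product $\prod_{s\in S}Y_s$ of sets *depends on $\aleph$ coordinates* if there is $T\subseteq S$ with $|T|\le\aleph$ such that $f(x')=f(x'')$ whenever $x'|_T=x''|_T$. For a map on $X_1\times\cdots\times X_n$ this is understood by identifying $X_1\times\cdots\times X_n$ with the product of all the spaces $X_{i,s}$ over the disjoint union of $S_1,\dots,S_n$. A map $f$ on $X_1\times\cdots\times X_n$ *depends on $\aleph$ coordinates with respect to the first variable* if there is $T\subseteq S_1$ with $|T|\le\aleph$ such that $f(x_1',x_2,\dots,x_n)=f(x_1'',x_2,\dots,x_n)$ for all $x_2\in X_2,\dots,x_n\in X_n$ and all $x_1',x_1''\in X_1$ with $x_1'|_T=x_1''|_T$. A function on $X_1\times\cdots\times X_n$ is *separately continuous* if it is continuous in each variable $x_i\in X_i$ when the other variables are fixed. A topological space $Y$ has property - (I$_\aleph$)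 if every locally finite indexed family of nonempty open subsets of $Y$ has an index set of cardinality $\le\aleph$; - (II$_\aleph$) if every indexed family of nonempty open subsets of $Y$ such that each point of $Y$ belongs to only finitely many members (counted by indices) has an index set of cardinality $\le\aleph$; - (III$_\aleph$) if every indexed family of nonempty open subsets of $Y$ such that each point of $Y$ belongs to at most $\aleph$ members (counted by indices) has an index set of cardinality $\le\aleph$. Finally, $d(Y)$ denotes the density of $Y$, the least cardinality of a dense subset. Then the following ten conditions are equivalent: 1. every separately continuous function $f:X_1\times\cdots\times X_n\to\mathbb R$ depends on $\aleph$ coordinates; 2. every separately continuous function $f:X_1\times\cdots\times X_n\to\mathbb R$ depends on $\aleph$ coordinates with respect to the first variable; 3. every continuous function $f:X\to\mathbb R$ depends on $\aleph$ coordinates; 4. $X$ has (I$_\aleph$); 5. every space $X_{i,s}$ has (I$_\aleph$); 6. $X$ has (II$_\aleph$); 7. every space $X_{i,s}$ has (II$_\aleph$); 8. $X$ has (III$_\aleph$); 9. every space $X_{i,s}$ has (III$_\aleph$); 10. $d(X_{i,s})\le\aleph$ for all $i$ and $s$. -/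

import Mathlib

open scoped Cardinal

universe u v w

namespace SeparateDependence

/-- A map `f` on a product `∏ s, X s` depends on (at most) `κ` coordinates: it is concentrated on
some set `T` of indices with `#T ≤ κ`. (`DependsOn f T` says that `f x' = f x''` whenever `x'` and
`x''` coincide on `T`.) -/
def DependsOnCard {S : Type u} {X : S → Type v} {Z : Type w} (κ : Cardinal.{u})
    (f : (∀ s, X s) → Z) : Prop :=
  ∃ T : Set S, #T ≤ κ ∧ DependsOn f T

section Iterated

variable {ι : Type} {S : ι → Type u} {X : ∀ i, S i → Type v} {Z : Type w}

/-- A map on `∏ i, ∏ s, X i s` depends on `κ` coordinates, where the domain is identified with the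
product of all the spaces `X i s` over the direct sum of the index sets `S i`. -/
def DependsOnCardTotal (κ : Cardinal.{u}) (f : (∀ i, ∀ s, X i s) → Z) : Prop :=
  DependsOnCard κ fun y : ∀ p : (Σ i, S i), X p.1 p.2 => f fun i s => y ⟨i, s⟩

/-- A map on `∏ i, ∏ s, X i s` depends on `κ` coordinates with respect to the `i`-th variable:
writing it as a map of `xᵢ ∈ ∏ s, X i s` and of the tuple of the other variables, the map sending
`xᵢ` to the corresponding function of the other variables depends on `κ` coordinates. -/
def DependsOnCardWrt [DecidableEq ι] (κ : Cardinal.{u}) (i : ι)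
    (f : (∀ i, ∀ s, X i s) → Z) : Prop :=
  DependsOnCard κ fun (xi : ∀ s, X i s) (xhat : ∀ j : {j // j ≠ i}, ∀ s, X j s) =>
    f ((Equiv.piSplitAt i fun j => ∀ s, X j s).symm (xi, xhat))

end Iterated

/-- A map of several variables is separately continuous: it is continuous in each variable when
all the other variables are fixed. -/
def SeparatelyContinuous {ι : Type} [DecidableEq ι] {X : ι → Type v}
    [∀ i, TopologicalSpace (X i)] {Z : Type w} [TopologicalSpace Z]
    (f : (∀ i, X i) → Z) : Prop :=
  ∀ (x : ∀ i, X i) (i : ι), Continuous fun t : X i => f (Function.update x i t)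

/-- Property (I): every locally finite family of nonempty open subsets has cardinality `≤ κ`.
Families indexed by types in the universe of `κ` suffice here and below, because a family of
cardinality `> κ` has a subfamily of cardinality exactly the successor of `κ`. -/
def PropI (κ : Cardinal.{u}) (X : Type u) [TopologicalSpace X] : Prop :=
  ∀ (I : Type u) (A : I → Set X), (∀ i, IsOpen (A i)) → (∀ i, (A i).Nonempty) →
    LocallyFinite A → #I ≤ κ

/-- Property (II): every pointwise finite family of nonempty open subsets has
cardinality `≤ κ`. -/
def PropII (κ : Cardinal.{u}) (X : Type u) [TopologicalSpace X] : Prop :=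
  ∀ (I : Type u) (A : I → Set X), (∀ i, IsOpen (A i)) → (∀ i, (A i).Nonempty) →
    (∀ x, {i | x ∈ A i}.Finite) → #I ≤ κ

/-- Property (III): every family of nonempty open subsets such that each point belongs to
at most `κ` members has cardinality `≤ κ`. -/
def PropIII (κ : Cardinal.{u}) (X : Type u) [TopologicalSpace X] : Prop :=
  ∀ (I : Type u) (A : I → Set X), (∀ i, IsOpen (A i)) → (∀ i, (A i).Nonempty) →
    (∀ x, #{i | x ∈ A i} ≤ κ) → #I ≤ κ

/-- The density of a topological space: the least cardinality of a dense subset. -/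
noncomputable def density (X : Type u) [TopologicalSpace X] : Cardinal.{u} :=
  sInf {c | ∃ A : Set X, Dense A ∧ #A = c}

end SeparateDependence

open Set Function Topology

namespace SeparateDependence

/-! ### Covering properties and dense families -/

section Properties

variable {κ : Cardinal.{u}} {X Y : Type u} [TopologicalSpace X] [TopologicalSpace Y]

/-! Everything passes through the density bound. If all factors have density at most `κ`, a
Hewitt–Marczewski–Pondiczery argument (`exists_family_meeting_boxes`) yields `κ` points meeting
every member of a family of `κ⁺` open sets, since shrinking the members to boxes involves only `κ⁺ ≤
2 ^ κ` coordinates. Hence each variable ranges over a space with (III), and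
`mk_le_of_separately_open` extends this to separately open families in the finite product. For a
separately continuous `f`, the points where a prescribed change of one coordinate moves `f` by more
than `1 / (m + 1)` form a separately open set, and each point lies in finitely many of these. So
only `κ` coordinates are essential, and continuity in each variable makes `f` depend on them alone.
Conversely, a metrizable space of density above `κ` contains more than `κ` points at mutual distance
at least some `ε > 0`. Bumps around them violate (I). Multiplied by functions of distinct
coordinates of the first variable and summed, they give a continuous function with more than `κ`
essential coordinates there. -/

theorem PropIII.propII (hκ : Cardinal.aleph0 ≤ κ) (h : PropIII κ X) : PropII κ X :=
  fun I A ho hne hf => h I A ho hne fun x =>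
    ((Cardinal.lt_aleph0_iff_set_finite.2 (hf x)).le.trans hκ)

theorem PropII.propI (h : PropII κ X) : PropI κ X :=
  fun I A ho hne hf => h I A ho hne fun x => hf.point_finite x

theorem PropI.of_surjective (h : PropI κ X) {g : X → Y} (hg : Continuous g)
    (hs : Surjective g) : PropI κ Y :=
  fun I A ho hne hf => h I (fun i => g ⁻¹' A i) (fun i => (ho i).preimage hg)
    (fun i => (hne i).preimage hs) (hf.preimage_continuous hg)

theorem PropIII.of_surjective (h : PropIII κ X) {g : X → Y} (hg : Continuous g)
    (hs : Surjective g) : PropIII κ Y :=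
  fun I A ho hne hf => h I (fun i => g ⁻¹' A i) (fun i => (ho i).preimage hg)
    (fun i => (hne i).preimage hs) (fun x => hf (g x))

/-- A nonempty space of density at most `κ` is the closure of the range of a family indexed by
any given type of cardinality `κ`. -/
theorem exists_denseRange_of_density_le [Nonempty X] {K : Type u} (h : density X ≤ #K) :
    ∃ d : K → X, DenseRange d := by
  have hne : {c | ∃ A : Set X, Dense A ∧ #A = c}.Nonempty := ⟨_, univ, dense_univ, rfl⟩
  obtain ⟨A, hA, hAc⟩ := csInf_mem hne
  have hle : #A ≤ #K := hAc.trans_le h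
  obtain ⟨e⟩ := hle
  have : Nonempty A := hA.nonempty.to_subtype
  refine ⟨fun k => ((invFun e k : A) : X), ?_⟩
  have hs : Surjective (invFun e) := invFun_surjective e.injective
  have : range (fun k => ((invFun e k : A) : X)) = A := by
    rw [range_comp' Subtype.val (invFun e), hs.range_eq, image_univ, Subtype.range_val]
  rw [DenseRange, this]
  exact hA

end Properties

/-! ### Property (III) for arbitrary products -/

section Product

variable {S : Type u} {Y : S → Type u} [∀ s, TopologicalSpace (Y s)]

/-- The combinatorial core of the Hewitt–Marczewski–Pondiczery theorem: if the indices in `J` are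
separated by the subsets `e s` of an infinite set `K`, and every factor has a dense family indexed
by `K`, then there are at most `#K` points of the product meeting every box supported in `J`. -/
theorem exists_family_meeting_boxes {K : Type u} [Infinite K] {J : Set S} {e : S → Set K}
    (he : InjOn e J) {d : ∀ s, K → Y s} (hd : ∀ s, DenseRange (d s)) :
    ∃ (L : Type u) (q : L → ∀ s, Y s), #L ≤ #K ∧
      ∀ (F : Finset S) (U : ∀ s, Set (Y s)), (F : Set S) ⊆ J →
        (∀ s ∈ F, IsOpen (U s)) → (∀ s ∈ F, (U s).Nonempty) → ∃ l, ∀ s ∈ F, q l s ∈ U s := by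
  classical
  -- An index is a finite `a ⊆ K` with a labelling of its subsets by `K`; coordinate `s` takes the
  -- label of the trace `a ∩ e s`. Once `a` separates the traces over `F`, the labels there can be
  -- prescribed freely.
  refine ⟨Σ a : Finset K, (Finset.powerset a → K),
    fun l s => d s (l.2 ⟨l.1.filter (· ∈ e s), by simp⟩), ?_, ?_⟩
  · rw [Cardinal.mk_sigma]
    refine (Cardinal.sum_le_sum _ (fun _ => #K) fun a => ?_).trans ?_
    · rw [← Cardinal.power_def]
      rw [Cardinal.mk_fintype (Finset.powerset a)]
      exact Cardinal.power_nat_le (Cardinal.infinite_iff.1 ‹_›)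
    · simp
  · intro F U hFJ ho hne
    have hsep : ∀ s t : S, ∃ k : K, e s ≠ e t → ¬ (k ∈ e s ↔ k ∈ e t) := by
      intro s t
      by_cases h : e s = e t
      · exact ⟨Classical.arbitrary K, fun h' => (h' h).elim⟩
      · obtain ⟨k, hk⟩ := not_forall.1 fun h' => h (Set.ext h')
        exact ⟨k, fun _ => hk⟩
    choose k hk using hsep
    let a : Finset K := (F ×ˢ F).image fun p => k p.1 p.2
    have hinj : ∀ s ∈ F, ∀ t ∈ F, a.filter (· ∈ e s) = a.filter (· ∈ e t) → s = t := by
      intro s hs t ht hst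
      by_contra hne'
      have h1 : e s ≠ e t := fun h => hne' (he (hFJ hs) (hFJ ht) h)
      have h2 : k s t ∈ a := Finset.mem_image.2 ⟨(s, t), by simp [hs, ht], rfl⟩
      apply hk s t h1
      have := Finset.ext_iff.1 hst (k s t)
      simpa [h2] using this
    have hc : ∀ s : S, ∃ c : K, s ∈ F → d s c ∈ U s := by
      intro s
      by_cases hs : s ∈ F
      · obtain ⟨c, hc⟩ := (hd s).exists_mem_open (ho s hs) (hne s hs)
        exact ⟨c, fun _ => hc⟩
      · exact ⟨Classical.arbitrary K, fun h => (hs h).elim⟩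
    choose c hc using hc
    let g : Finset.powerset a → K := fun b =>
      if h : ∃ s ∈ F, a.filter (· ∈ e s) = b.1 then c h.choose else Classical.arbitrary K
    refine ⟨⟨a, g⟩, fun s hs => ?_⟩
    have hex : ∃ t ∈ F, a.filter (· ∈ e t) = a.filter (· ∈ e s) := ⟨s, hs, rfl⟩
    have hg : g ⟨a.filter (· ∈ e s), by simp⟩ = c s := by
      have h1 := hinj _ hex.choose_spec.1 _ hs hex.choose_spec.2
      simp only [g]
      rw [dif_pos hex, h1]
    change d s (g ⟨a.filter (· ∈ e s), _⟩) ∈ U s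
    rw [hg]
    exact hc s hs

/-- A product of nonempty spaces of density at most `κ` has property (III). -/
theorem propIII_pi {κ : Cardinal.{u}} (hκ : Cardinal.aleph0 ≤ κ) [∀ s, Nonempty (Y s)]
    (h : ∀ s, density (Y s) ≤ κ) : PropIII κ (∀ s, Y s) := by
  classical
  intro I A ho hne hmult
  by_contra! hI
  obtain ⟨I', hI'⟩ := Cardinal.le_mk_iff_exists_set.1 (Order.succ_le_of_lt hI)
  have hbox : ∀ i, ∃ (F : Finset S) (U : ∀ s, Set (Y s)), (∀ s ∈ F, IsOpen (U s)) ∧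
      (∀ s ∈ F, (U s).Nonempty) ∧ (F : Set S).pi U ⊆ A i := by
    intro i
    obtain ⟨p, hp⟩ := hne i
    obtain ⟨F, U, hU, hsub⟩ := isOpen_pi_iff.1 (ho i) p hp
    exact ⟨F, U, fun s hs => (hU s hs).1, fun s hs => ⟨_, (hU s hs).2⟩, hsub⟩
  choose F U hUo hUne hUA using hbox
  induction κ using Cardinal.inductionOn with | _ K
  have : Infinite K := Cardinal.infinite_iff.2 hκ
  let J : Set S := ⋃ i : I', (F i : Set S)
  -- `I'` has exactly `κ⁺` members, so the supports total at most `κ⁺ * ℵ₀ = κ⁺ ≤ 2 ^ κ`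
  -- coordinates.
  have hJ : #J ≤ #(Set K) := by
    rw [Cardinal.mk_set]
    refine (Cardinal.mk_iUnion_le _).trans ?_
    rw [hI']
    refine (mul_le_mul_right (ciSup_le' (a := Cardinal.aleph0) fun i => ?_) _).trans ?_
    · exact (Cardinal.lt_aleph0_iff_set_finite.2 (F i).finite_toSet).le
    · rw [Cardinal.mul_eq_left (hκ.trans (Order.le_succ _)) (hκ.trans (Order.le_succ _))
        Cardinal.aleph0_ne_zero]
      exact Order.succ_le_of_lt (Cardinal.cantor _)
  obtain ⟨e⟩ := hJ
  choose d hd using fun s => exists_denseRange_of_density_le (h s)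
  obtain ⟨L, q, hL, hq⟩ := exists_family_meeting_boxes (J := J)
    (e := fun s => if hs : s ∈ J then e ⟨s, hs⟩ else ∅)
    (by
      intro s hs t ht hst
      simp only [dif_pos hs, dif_pos ht] at hst
      exact congrArg Subtype.val (e.injective hst)) hd
  have hcover : I' ⊆ ⋃ l, {i | q l ∈ A i} := by
    intro i hi
    obtain ⟨l, hl⟩ := hq (F i) (U i) (subset_iUnion (fun i : I' => (F i : Set S)) ⟨i, hi⟩)
      (hUo i) (hUne i)
    exact mem_iUnion.2 ⟨l, hUA i hl⟩
  have : #I' ≤ #K := calc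
    #I' ≤ #(⋃ l, {i | q l ∈ A i}) := Cardinal.mk_le_mk_of_subset hcover
    _ ≤ #L * ⨆ l, #{i | q l ∈ A i} := Cardinal.mk_iUnion_le _
    _ ≤ #K * #K := mul_le_mul' hL (ciSup_le' fun l => hmult (q l))
    _ = #K := Cardinal.mul_eq_self hκ
  rw [hI'] at this
  exact (Order.lt_succ (#K)).not_ge this

end Product

/-! ### Separately open families in finite products -/

section SeparatelyOpen

variable {ι : Type} [Finite ι] [DecidableEq ι] {X : ι → Type u}
  [∀ i, TopologicalSpace (X i)] {κ : Cardinal.{u}}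

/-- If all the factors of a finite product have property (III), then so does the product with
respect to families of sets that are open in each variable separately. -/
theorem mk_le_of_separately_open (h : ∀ i, PropIII κ (X i)) {I : Type u}
    (A : I → Set (∀ i, X i))
    (ho : ∀ j x i, IsOpen {t | update x i t ∈ A j}) (hne : ∀ j, (A j).Nonempty)
    (hm : ∀ x, #{j | x ∈ A j} ≤ κ) : #I ≤ κ := by
  classical
  cases nonempty_fintype ι
  by_contra! hI
  choose p hp using hne
  -- The points `p j` are merged into a common point one variable at a time, always keeping more
  -- than `κ` indices; `F` holds the variables already merged.
  have key : ∀ F : Finset ι, ∃ x : ∀ i, X i, κ < #{j | F.piecewise x (p j) ∈ A j} := by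
    intro F
    induction F using Finset.induction_on with
    | empty =>
      have : Nonempty I := Cardinal.mk_ne_zero_iff.1 (bot_le.trans_lt hI).ne'
      refine ⟨p (Classical.arbitrary I), ?_⟩
      simpa [hp] using hI
    | insert a F ha ih =>
      obtain ⟨x, hx⟩ := ih
      let I' := {j | F.piecewise x (p j) ∈ A j}
      -- The slices in direction `a` of the surviving sets are open and nonempty, so by (III) some
      -- `t` lies in more than `κ` of them.
      have hIII := h a I' (fun j => {t | update (F.piecewise x (p j)) a t ∈ A j})
        (fun j => ho _ _ _) fun j => by
          refine ⟨p j a, ?_⟩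
          have h1 : F.piecewise x (p j) a = p j a := by simp [ha]
          rw [mem_ofPred_eq, ← h1, update_eq_self]
          exact j.2
      have hnot := mt hIII hx.not_ge
      push Not at hnot
      obtain ⟨t, ht⟩ := hnot
      refine ⟨update x a t, ht.trans_le ?_⟩
      refine Cardinal.mk_le_of_injective (f := fun j => ⟨j.1.1, ?_⟩) ?_
      · have h2 := j.2
        rw [mem_ofPred_eq, Finset.piecewise_insert, update_self]
        rw [mem_ofPred_eq, mem_ofPred_eq] at h2
        convert h2 using 2
        ext i
        by_cases hi : i ∈ F
        · have : i ≠ a := fun h => ha (h ▸ hi)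
          simp [hi, this]
        · simp [hi]
      · intro j k hjk
        exact Subtype.ext (Subtype.ext (Subtype.mk.inj hjk))
  obtain ⟨x, hx⟩ := key Finset.univ
  simp only [Finset.piecewise_univ] at hx
  exact hx.not_ge (hm x)

end SeparatelyOpen

/-! ### Continuous functions on one product -/

section OneVariable

variable {S : Type u} {Y : S → Type v} [∀ s, TopologicalSpace (Y s)] {g : (∀ s, Y s) → ℝ}

/-- A basic neighbourhood in the product topology restricts only finitely many coordinates. -/
theorem exists_finset_abs_sub_lt (hg : Continuous g) (y : ∀ s, Y s) {ε : ℝ} (hε : 0 < ε) :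
    ∃ F : Finset S, ∀ z, (∀ s ∈ F, z s = y s) → |g z - g y| < ε := by
  have ho : IsOpen {z | |g z - g y| < ε} := isOpen_lt (by fun_prop) continuous_const
  obtain ⟨F, U, hU, hsub⟩ := isOpen_pi_iff.1 ho y (by simpa using hε)
  refine ⟨F, fun z hz => hsub fun s hs => ?_⟩
  rw [hz s hs]
  exact (hU s hs).2

/-- A continuous function depends on the set of its essential coordinates. -/
theorem eq_of_update_eq [DecidableEq S] (hg : Continuous g) {T : Set S}
    (hT : ∀ s ∉ T, ∀ y t, g (update y s t) = g y)
    {y z : ∀ s, Y s} (hyz : ∀ s ∈ T, y s = z s) : g y = g z := by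
  have key : ∀ F : Finset S, g (F.piecewise y z) = g z := by
    intro F
    induction F using Finset.induction_on with
    | empty => simp
    | insert a F ha ih =>
      rw [Finset.piecewise_insert]
      by_cases haT : a ∈ T
      · have : F.piecewise y z a = y a := by simp [ha, hyz a haT]
        rw [← this, update_eq_self, ih]
      · rw [hT a haT, ih]
  by_contra hne
  -- The tolerance is `|g z - g y|` itself: the point agreeing with `y` on `F` and with `z`
  -- elsewhere has value `g z`, yet must be strictly closer to `g y`.
  obtain ⟨F, hF⟩ := exists_finset_abs_sub_lt hg y (abs_pos.2 (sub_ne_zero.2 (Ne.symm hne)))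
  have := hF (F.piecewise y z) fun s hs => by simp [hs]
  rw [key] at this
  exact lt_irrefl _ this

end OneVariable

theorem DependsOnCardTotal.dependsOnCardWrt {κ : Cardinal.{u}} {ι : Type} [DecidableEq ι]
    {S : ι → Type u} {X : ∀ i, S i → Type v} {Z : Type w} {f : (∀ i, ∀ s, X i s) → Z}
    (h : DependsOnCardTotal κ f) (i : ι) : DependsOnCardWrt κ i f := by
  obtain ⟨T, hT, hd⟩ := h
  refine ⟨Sigma.mk i ⁻¹' T,
    (Cardinal.mk_preimage_of_injective _ _ sigma_mk_injective).trans hT, ?_⟩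
  intro x y hxy
  funext xhat
  refine hd (x := fun p => (Equiv.piSplitAt i fun j => ∀ s, X j s).symm (x, xhat) p.1 p.2)
    (y := fun p => (Equiv.piSplitAt i fun j => ∀ s, X j s).symm (y, xhat) p.1 p.2) ?_
  rintro ⟨j, s⟩ hp
  by_cases hj : j = i
  · subst hj
    simpa using hxy s hp
  · simp [hj]

/-! ### Essential coordinates of separately continuous functions -/

section SeparatelyContinuous

variable {ι : Type} [Finite ι] [DecidableEq ι] {S : ι → Type u} {X : ∀ i, S i → Type u}
  [∀ i s, TopologicalSpace (X i s)] {κ : Cardinal.{u}}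

/-- If every variable ranges over a product with property (III), then a separately continuous
function has at most `κ` essential coordinates, and it depends on them. -/
theorem SeparatelyContinuous.dependsOnCardTotal (hκ : Cardinal.aleph0 ≤ κ)
    (h : ∀ i, PropIII κ (∀ s, X i s)) {f : (∀ i, ∀ s, X i s) → ℝ}
    (hf : SeparatelyContinuous f) : DependsOnCardTotal κ f := by
  classical
  cases nonempty_fintype ι
  let c : ∀ p : (Σ i, S i), X p.1 p.2 → (∀ i, ∀ s, X i s) → ∀ i, ∀ s, X i s :=
    fun p t x => update x p.1 (update (x p.1) p.2 t)
  let E : ℕ → Set (Σ i, S i) := fun m =>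
    {p | ∃ t x, 1 / ((m : ℝ) + 1) < |f (c p t x) - f x|}
  have hE : ∀ m, #(E m) ≤ κ := by
    intro m
    choose t ht using fun p : E m => p.2
    refine mk_le_of_separately_open h
      (fun p : E m => {x | 1 / ((m : ℝ) + 1) < |f (c p (t p) x) - f x|}) ?_ ht ?_
    · intro p x i
      refine isOpen_lt continuous_const (Continuous.abs (Continuous.sub ?_ (hf x i)))
      by_cases hi : i = p.1.1
      · subst hi
        simp only [c, update_self, update_idem]
        exact (hf x _).comp (continuous_id.update _ continuous_const)
      · have : ∀ u, c p (t p) (update x i u) = update (c p (t p) x) i u := by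
          intro u
          simp only [c]
          rw [update_of_ne (Ne.symm hi), update_comm (Ne.symm hi)]
        simp only [this]
        exact hf _ i
    · intro x
      refine (Cardinal.lt_aleph0_iff_set_finite.2 ?_).le.trans hκ
      -- In each variable, changes off a finite set `F i` move `f` by less than `1 / (m + 1)`, so
      -- only indices `p` in the finite sum of the `F i` can have `x` in their set.
      have hF : ∀ i, ∃ F : Finset (S i), ∀ z : ∀ s, X i s, (∀ s ∈ F, z s = x i s) →
          |f (update x i z) - f (update x i (x i))| < 1 / ((m : ℝ) + 1) := fun i =>
        exists_finset_abs_sub_lt (hf x i) (x i) (by positivity)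
      choose F hF using hF
      refine Finite.of_finite_image (f := Subtype.val) ?_ Subtype.val_injective.injOn
      refine (Finset.univ.sigma F).finite_toSet.subset ?_
      rintro _ ⟨p, hp, rfl⟩
      by_contra hpF
      have hps : p.1.2 ∉ F p.1.1 := by simpa using hpF
      have h1 := hF p.1.1 (update (x p.1.1) p.1.2 (t p)) fun s hs =>
        update_of_ne (ne_of_mem_of_not_mem hs hps) _ _
      rw [update_eq_self] at h1
      exact lt_asymm hp h1
  refine ⟨⋃ m, E m, ?_, ?_⟩
  · have h1 := Cardinal.mk_iUnion_le_lift E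
    rw [Cardinal.lift_id'.{0, u}] at h1
    refine h1.trans ?_
    refine (mul_le_mul' (b := κ) (d := κ) ?_ ?_).trans_eq (Cardinal.mul_eq_self hκ)
    · simpa using hκ
    · exact ciSup_le' fun m => by simpa using hE m
  · have hT : ∀ p ∉ ⋃ m, E m, ∀ t x, f (c p t x) = f x := by
      intro p hp t x
      by_contra hne
      obtain ⟨m, hm⟩ := exists_nat_one_div_lt (abs_pos.2 (sub_ne_zero.2 hne))
      exact hp (mem_iUnion.2 ⟨m, t, x, hm⟩)
    intro y z hyz
    let y' : ∀ i, ∀ s, X i s := fun i s => y ⟨i, s⟩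
    let z' : ∀ i, ∀ s, X i s := fun i s => z ⟨i, s⟩
    have key : ∀ F : Finset ι, f (F.piecewise y' z') = f z' := by
      intro F
      induction F using Finset.induction_on with
      | empty => simp
      | insert a F ha ih =>
        rw [Finset.piecewise_insert, ← ih]
        have h1 := eq_of_update_eq (hf (F.piecewise y' z') a) (T := {s | ⟨a, s⟩ ∈ ⋃ m, E m})
          (y := y' a) (z := F.piecewise y' z' a) (fun s hs u t => ?_) fun s hs => ?_
        · rwa [update_eq_self] at h1
        · have := hT ⟨a, s⟩ hs t (update (F.piecewise y' z') a u)
          simpa only [c, update_self, update_idem] using this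
        · simp only [Finset.piecewise_eq_of_notMem _ _ _ ha]
          exact hyz ⟨a, s⟩ hs
    have := key Finset.univ
    rwa [Finset.piecewise_univ] at this

end SeparatelyContinuous

/-! ### Metrizable factors of large density -/

/-- A metrizable space of density greater than `κ` carries a locally finite family of more than
`κ` nonzero continuous functions. -/
theorem exists_locallyFinite_of_lt_density {κ : Cardinal.{u}} (hκ : Cardinal.aleph0 ≤ κ)
    {Y : Type u} [TopologicalSpace Y] [TopologicalSpace.MetrizableSpace Y] (h : κ < density Y) :
    ∃ (I : Type u) (φ : I → Y → ℝ), κ < #I ∧ (∀ i, Continuous (φ i)) ∧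
      (∀ i, ∃ y, φ i y ≠ 0) ∧ LocallyFinite fun i => support (φ i) := by
  let _ := TopologicalSpace.metrizableSpaceMetric Y
  have hmax : ∀ m : ℕ, ∃ A : Set Y, Maximal
      (fun A : Set Y => A.Pairwise fun a b => 1 / ((m : ℝ) + 1) ≤ dist a b) A := by
    intro m
    obtain ⟨A, -, hA⟩ := zorn_subset_nonempty
      {A : Set Y | A.Pairwise fun a b => 1 / ((m : ℝ) + 1) ≤ dist a b}
      (fun C hC hch _ => ⟨⋃₀ C, (pairwise_sUnion hch.directedOn).2 fun s hs => hC hs,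
        fun s hs => subset_sUnion_of_mem hs⟩) ∅ (pairwise_empty _)
    exact ⟨A, hA⟩
  choose A hA using hmax
  -- By maximality each `A m` is a `1 / (m + 1)`-net; hence one `A m` already has more than `κ`
  -- points.
  have hdense : Dense (⋃ m, A m) := by
    rw [Metric.dense_iff]
    intro y r hr
    obtain ⟨m, hm⟩ := exists_nat_one_div_lt hr
    suffices ∃ a ∈ A m, dist a y < 1 / ((m : ℝ) + 1) by
      obtain ⟨a, ha, hay⟩ := this
      exact ⟨a, hay.trans hm, mem_iUnion.2 ⟨m, ha⟩⟩
    by_contra! hcon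
    have hins : (insert y (A m)).Pairwise fun a b => 1 / ((m : ℝ) + 1) ≤ dist a b :=
      (hA m).prop.insert fun b hb _ => ⟨by rw [dist_comm]; exact hcon b hb, hcon b hb⟩
    have hy : y ∈ A m := (hA m).le_of_ge hins (subset_insert _ _) (mem_insert _ _)
    have := hcon y hy
    rw [dist_self] at this
    have : (0 : ℝ) < 1 / ((m : ℝ) + 1) := by positivity
    linarith
  obtain ⟨m, hm⟩ : ∃ m, κ < #(A m) := by
    by_contra! hcon
    have hle : density Y ≤ #(⋃ m, A m) := csInf_le' ⟨_, hdense, rfl⟩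
    refine h.not_ge (hle.trans ?_)
    have h1 := Cardinal.mk_iUnion_le_lift A
    rw [Cardinal.lift_id'.{0, u}] at h1
    refine h1.trans ?_
    refine (mul_le_mul' (b := κ) (d := κ) ?_ ?_).trans_eq (Cardinal.mul_eq_self hκ)
    · simpa using hκ
    · exact ciSup_le' fun m => by simpa using hcon m
  set ε : ℝ := 1 / ((m : ℝ) + 1) with hε
  have hε0 : 0 < ε := by positivity
  have hsupp : ∀ (a : A m) (y : Y), max 0 (ε / 4 - dist y a) ≠ 0 → dist y a < ε / 4 := by
    intro a y hy
    by_contra! hcon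
    exact hy (max_eq_left (by linarith))
  refine ⟨A m, fun a y => max 0 (ε / 4 - dist y a), hm, fun a => by fun_prop,
    fun a => ⟨a, ?_⟩, fun y => ⟨Metric.ball y (ε / 4), Metric.ball_mem_nhds _ (by positivity), ?_⟩⟩
  · have : 0 < ε / 4 - dist (a : Y) a := by rw [dist_self]; linarith
    exact (lt_max_of_lt_right this).ne'
  -- If the ball meets the bumps at `a` and `b`, the path `a, p, y, q, b` has four legs shorter than
  -- `ε / 4`, contradicting `ε ≤ dist a b`.
  · refine Set.Subsingleton.finite ?_
    rintro a ⟨p, hp, hpy⟩ b ⟨q, hq, hqy⟩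
    by_contra hab
    have h1 := (hA m).prop a.2 b.2 fun h => hab (Subtype.ext h)
    have h2 := hsupp a p hp
    have h3 := hsupp b q hq
    rw [Metric.mem_ball] at hpy hqy
    have h4 := dist_triangle4 (a : Y) p q b
    have h5 := dist_triangle_right p q y
    rw [dist_comm (a : Y) p] at h4
    linarith

/-- A metrizable space with property (I) has density at most `κ`. -/
theorem PropI.density_le {κ : Cardinal.{u}} (hκ : Cardinal.aleph0 ≤ κ)
    {Y : Type u} [TopologicalSpace Y] [TopologicalSpace.MetrizableSpace Y] (h : PropI κ Y) :
    density Y ≤ κ := by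
  by_contra! hd
  obtain ⟨I, φ, hI, hc, hne, hlf⟩ := exists_locallyFinite_of_lt_density hκ hd
  exact hI.not_ge (h I (fun i => support (φ i)) (fun i => isOpen_ne_fun (hc i) continuous_const)
    (fun i => hne i) hlf)

theorem exists_continuous_ne (Y : Type u) [TopologicalSpace Y]
    [TopologicalSpace.MetrizableSpace Y] [Nontrivial Y] :
    ∃ (ψ : Y → ℝ) (a b : Y), Continuous ψ ∧ ψ a ≠ ψ b := by
  let _ := TopologicalSpace.metrizableSpaceMetric Y
  obtain ⟨a, b, hab⟩ := exists_pair_ne Y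
  refine ⟨fun y => dist y b, a, b, by fun_prop, ?_⟩
  simpa using hab

/-- If more than `κ` coordinates are available in the variable `k` and every continuous function
depends on `κ` coordinates with respect to it, then all the factors have density at most `κ`. -/
theorem density_le_of_dependsOnCardWrt {κ : Cardinal.{u}} (hκ : Cardinal.aleph0 ≤ κ)
    {ι : Type} [DecidableEq ι] {S : ι → Type u} {X : ∀ i, S i → Type u}
    [∀ i s, TopologicalSpace (X i s)] [∀ i s, TopologicalSpace.MetrizableSpace (X i s)]
    [∀ i s, Nontrivial (X i s)] {k : ι} (hS : κ < #(S k))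
    (h : ∀ f : (∀ i, ∀ s, X i s) → ℝ, Continuous f → DependsOnCardWrt κ k f)
    (i : ι) (s : S i) : density (X i s) ≤ κ := by
  classical
  by_contra! hd
  obtain ⟨I, φ, hI, hφc, hφne, hlf⟩ := exists_locallyFinite_of_lt_density hκ hd
  -- The coordinate `(i, s)` is excluded because it may belong to the variable `k`; the two factors
  -- of each term below must involve different coordinates.
  let R : Set (S k) := {r | (⟨k, r⟩ : Σ i, S i) ≠ ⟨i, s⟩}
  have hR : κ < #R := by
    by_contra! hR
    have h1 : #(Rᶜ : Set (S k)) ≤ κ := by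
      have : (Rᶜ).Subsingleton := by
        intro r hr r' hr'
        simp only [R, mem_compl_iff, mem_ofPred_eq, not_not] at hr hr'
        exact sigma_mk_injective (hr.trans hr'.symm)
      exact (Cardinal.lt_aleph0_iff_set_finite.2 this.finite).le.trans hκ
    refine hS.not_ge ?_
    rw [← Cardinal.mk_sum_compl R]
    exact (add_le_add hR h1).trans_eq (Cardinal.add_eq_self hκ)
  obtain ⟨I', hI'⟩ := Cardinal.le_mk_iff_exists_set.1 (Order.succ_le_of_lt hI)
  have hle : #I' ≤ #R := hI'.trans_le (Order.succ_le_of_lt hR)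
  obtain ⟨e⟩ := hle
  choose ψ a b hψc hψ using fun r => exists_continuous_ne (X k r)
  let term : I' → (∀ i, ∀ s, X i s) → ℝ := fun j x => φ j (x i s) * ψ (e j) (x k (e j))
  have hcont : Continuous fun x => ∑ᶠ j, term j x := by
    refine continuous_finsum (fun j => ?_) ?_
    · exact ((hφc j).comp (by fun_prop)).mul ((hψc _).comp (by fun_prop))
    · have h1 : LocallyFinite fun j : I' => (fun x : ∀ i, ∀ s, X i s => x i s) ⁻¹' support (φ j) :=
        (hlf.comp_injective Subtype.val_injective).preimage_continuous (by fun_prop)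
      exact h1.subset fun j x hx => left_ne_zero_of_mul hx
  obtain ⟨T, hT, hdep⟩ := h _ hcont
  -- As `#T ≤ κ < #I'`, some `e j` escapes `T`. Changing that coordinate, with `(i, s)` fixed where
  -- `φ j ≠ 0`, alters only the `j`-th term.
  obtain ⟨j, hj⟩ : ∃ j : I', (e j : S k) ∉ T := by
    by_contra! hcon
    have h1 : #I' ≤ #T := Cardinal.mk_le_of_injective (f := fun j => ⟨e j, hcon j⟩)
      fun j j' hjj => e.injective (Subtype.ext (Subtype.mk.inj hjj))
    rw [hI'] at h1
    exact ((Order.lt_succ κ).trans_le h1).not_ge hT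
  obtain ⟨y, hy⟩ := hφne j
  let x₀ : ∀ i, ∀ s, X i s := fun i' s' =>
    if h : (⟨i', s'⟩ : Σ i, S i) = ⟨i, s⟩ then cast (by cases h; rfl) y else Classical.arbitrary _
  have hx₀ : x₀ i s = y := by simp [x₀]
  let x : X k (e j) → ∀ i, ∀ s, X i s := fun t => update x₀ k (update (x₀ k) (e j) t)
  have hxne : ∀ t i' s', (⟨i', s'⟩ : Σ i, S i) ≠ ⟨k, e j⟩ → x t i' s' = x₀ i' s' := by
    intro t i' s' hne
    by_cases hk : i' = k
    · subst hk
      have : s' ≠ e j := fun h => hne (h ▸ rfl)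
      simp [x, this]
    · simp [x, hk]
  have hxs : ∀ t, x t i s = y := fun t => (hxne t i s (e j).2.symm).trans hx₀
  have hfin : ∀ t, (support fun j' => term j' (x t)).Finite := by
    intro t
    refine ((hlf.comp_injective (g := ((↑) : I' → I)) Subtype.val_injective).point_finite y).subset
      fun j' hj' => ?_
    have := left_ne_zero_of_mul hj'
    rwa [hxs] at this
  have heq : ∑ᶠ j', term j' (x (a (e j))) = ∑ᶠ j', term j' (x (b (e j))) := by
    have h1 := congrFun (hdep (x := x (a (e j)) k) (y := x (b (e j)) k) fun r hr => by
      have : r ≠ e j := fun h => hj (h ▸ hr)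
      simp [x, this]) fun i' => x₀ i'
    have h2 : ∀ t, (Equiv.piSplitAt k fun j => ∀ s, X j s).symm (x t k, fun i' => x₀ i') = x t := by
      intro t
      rw [Equiv.symm_apply_eq]
      ext i'
      · rfl
      · simp [x, i'.2]
    simpa only [h2] using h1
  -- Subtracting termwise leaves `φ j y * (ψ (a (e j)) - ψ (b (e j))) = 0` (with the index `e j` of
  -- `ψ`, `a`, `b` abbreviated), although both factors are nonzero.
  have hsub : ∑ᶠ j', (term j' (x (a (e j))) - term j' (x (b (e j)))) = 0 := by
    rw [finsum_sub_distrib (hfin _) (hfin _), heq, sub_self]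
  rw [finsum_eq_single _ j] at hsub
  · simp only [term, hxs] at hsub
    rw [← mul_sub] at hsub
    rcases mul_eq_zero.1 hsub with h0 | h0
    · exact hy h0
    · refine hψ (e j) ?_
      simpa [x, sub_eq_zero] using h0
  · intro j' hj'
    have : (⟨k, e j'⟩ : Σ i, S i) ≠ ⟨k, e j⟩ := fun h =>
      hj' (e.injective (Subtype.ext (sigma_mk_injective h)))
    simp only [term, hxs, hxne _ _ _ this, sub_self]

end SeparateDependence

/-! ### The equivalences -/

theorem theorem4p3 {n : ℕ} [NeZero n] (κ : Cardinal.{u}) (hκ : Cardinal.aleph0 ≤ κ)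
    (S : Fin n → Type u) (X : ∀ i, S i → Type u)
    [∀ i s, TopologicalSpace (X i s)] [∀ i s, TopologicalSpace.MetrizableSpace (X i s)]
    [∀ i s, Nontrivial (X i s)] (hS : κ < Cardinal.mk (S 0)) :
    List.TFAE [
      ∀ f : (∀ i, ∀ s, X i s) → ℝ, SeparateDependence.SeparatelyContinuous f →
        SeparateDependence.DependsOnCardTotal κ f,
      ∀ f : (∀ i, ∀ s, X i s) → ℝ, SeparateDependence.SeparatelyContinuous f →
        SeparateDependence.DependsOnCardWrt κ 0 f,
      ∀ f : (∀ i, ∀ s, X i s) → ℝ, Continuous f →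
        SeparateDependence.DependsOnCardTotal κ f,
      SeparateDependence.PropI κ (∀ i, ∀ s, X i s),
      ∀ i s, SeparateDependence.PropI κ (X i s),
      SeparateDependence.PropII κ (∀ i, ∀ s, X i s),
      ∀ i s, SeparateDependence.PropII κ (X i s),
      SeparateDependence.PropIII κ (∀ i, ∀ s, X i s),
      ∀ i s, SeparateDependence.PropIII κ (X i s),
      ∀ i s, SeparateDependence.density (X i s) ≤ κ] := by
  have hsep : ∀ f : (∀ i, ∀ s, X i s) → ℝ, Continuous f →
      SeparateDependence.SeparatelyContinuous f := fun f hf x i =>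
    hf.comp (continuous_const.update i continuous_id)
  have hproj : ∀ i s, Continuous fun x : ∀ i, ∀ s, X i s => x i s := fun i s => by fun_prop
  have hsurj : ∀ i s, Function.Surjective fun x : ∀ i, ∀ s, X i s => x i s := fun i s =>
    (Function.surjective_eval s).comp (Function.surjective_eval i)
  have hpi : (∀ i s, SeparateDependence.density (X i s) ≤ κ) →
      ∀ i, SeparateDependence.PropIII κ (∀ s, X i s) := fun h i =>
    SeparateDependence.propIII_pi hκ (h i)
  tfae_have 10 → 1 := fun h f hf => hf.dependsOnCardTotal hκ (hpi h)
  tfae_have 1 → 3 := fun h f hf => h f (hsep f hf)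
  tfae_have 1 → 2 := fun h f hf => (h f hf).dependsOnCardWrt 0
  tfae_have 2 → 10 := fun h =>
    SeparateDependence.density_le_of_dependsOnCardWrt hκ hS fun f hf => h f (hsep f hf)
  tfae_have 3 → 10 := fun h =>
    SeparateDependence.density_le_of_dependsOnCardWrt hκ hS fun f hf => (h f hf).dependsOnCardWrt 0
  tfae_have 10 → 8 := fun h I A ho hne hm =>
    SeparateDependence.mk_le_of_separately_open (hpi h) A
      (fun j x i => (ho j).preimage (continuous_const.update i continuous_id)) hne hm
  tfae_have 8 → 9 := fun h i s => h.of_surjective (hproj i s) (hsurj i s)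
  tfae_have 9 → 7 := fun h i s => (h i s).propII hκ
  tfae_have 7 → 5 := fun h i s => (h i s).propI
  tfae_have 8 → 6 := fun h => h.propII hκ
  tfae_have 6 → 4 := fun h => h.propI
  tfae_have 4 → 5 := fun h i s => h.of_surjective (hproj i s) (hsurj i s)
  tfae_have 5 → 10 := fun h i s => (h i s).density_le hκ
  tfae_finish
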